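/- Let $n\ge 0$ and $0<r<R$ be given, and put $D_R=\{x\in\mathbb C: |x|<R\}$, $D_{r,R}=\{x\in\mathbb C: r<|x|<R\}$. Let $\mathcal O_R$ and $\mathcal O_{r,R}$ be the rings of analytic functions on $D_R$ and on $D_{r,R}$. A $D_R$- (resp. $D_{r,R}$-) transversely formal vector field is a $\mathbb C$-linear derivation of the ring of formal power series $\mathcal O_R[[z_1,\dots,z_n]]$ (resp. $\mathcal O_{r,R}[[z_1,\dots,z_n]]$), with the commutator as Lie bracket. It is called $x$-normalized if it has the form $$x\,\partial_x+\sum_{i=1}^n\sum_{j=1}^n a_{ij}z_j\,\partial_{z_i}+\sum_{i=1}^n b_i(x,\mathbf z)\,\partial_{z_i},$$ where $(a_{ij})$ is a constant complex matrix and $b_1,\dots,b_n$ belong to the ideal generated by the monomials $z_iz_j$ ($1\le i,j\le n$) of that ring. Restricting the coefficient functions from $D_R$ to $D_{r,R}$, every $D_R$-transversely formal vector field is regarded as a $D_{r,R}$-transversely formal one. A $D_R$-transversely formal vector field whose linear part at the origin has the eigenvalues $1,\mu_1,\dots,\mu_n$ (with multiplicity) has no transverse negative resonance if $\sum_{i=1}^n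 p_i\mu_i\neq\mu_j+q$ for all $p\in\mathbb Z_{\ge0}^n$ with $p_1+\dots+p_n\ge1$, all $1\le j\le n$ and all integers $q\ge1$. Theorem. Let $X$ be an $x$-normalized $D_R$-transversely formal vector field with no transverse negative resonance, and let $Y$ be an $x$-normalized $D_{r,R}$-transversely formal vector field. If $[X,Y]=0$ (as $D_{r,R}$-transversely formal vector fields), then $Y$ is an $x$-normalized $D_R$-transversely formal vector field; that is, $Y$ is the restriction to $D_{r,R}$ of an $x$-normalized $D_R$-transversely formal vector field. -/

import Mathlib

noncomputable section

namespace TransverselyFormal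

/-- The disk `D_R = {x ∈ ℂ ; |x| < R}`. -/
def disk (R : ℝ) : TopologicalSpace.Opens ℂ where
  carrier := {x | ‖x‖ < R}
  is_open' := isOpen_lt continuous_norm continuous_const

/-- The annulus `D_{r,R} = {x ∈ ℂ ; r < |x| < R}`. -/
def annulus (r R : ℝ) : TopologicalSpace.Opens ℂ where
  carrier := {x | r < ‖x‖ ∧ ‖x‖ < R}
  is_open' := (isOpen_lt continuous_const continuous_norm).inter
    (isOpen_lt continuous_norm continuous_const)

theorem annulus_le_disk (r R : ℝ) : annulus r R ≤ disk R := fun _ hx => hx.2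

theorem zero_mem_disk {R : ℝ} (hR : 0 < R) : (0 : ℂ) ∈ disk R := by
  change ‖(0 : ℂ)‖ < R
  simpa using hR

/-- Extension by zero of a function on the open set `U` to all of `ℂ`. -/
def extendZero (U : TopologicalSpace.Opens ℂ) (f : U → ℂ) : ℂ → ℂ :=
  Function.extend Subtype.val f 0

theorem extendZero_apply {U : TopologicalSpace.Opens ℂ} (f : U → ℂ) (x : U) :
    extendZero U f x = f x :=
  Subtype.val_injective.extend_apply f 0 x

theorem extendZero_congr {U : TopologicalSpace.Opens ℂ} {f : U → ℂ} {F : ℂ → ℂ}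
    (h : ∀ x : U, f x = F x) : Set.EqOn F (extendZero U f) U := fun x hx => by
  rw [← h ⟨x, hx⟩, ← extendZero_apply f ⟨x, hx⟩]

theorem analyticOnNhd_extendZero {U : TopologicalSpace.Opens ℂ} {f : U → ℂ} {F : ℂ → ℂ}
    (hF : AnalyticOnNhd ℂ F U) (h : ∀ x : U, f x = F x) :
    AnalyticOnNhd ℂ (extendZero U f) U :=
  hF.congr U.isOpen (extendZero_congr h)

/-- The ring of analytic functions on the open set `U ⊆ ℂ`. With `U = disk R` this is `𝒪_R`,
with `U = annulus r R` it is `𝒪_{r,R}`. -/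
def Hol (U : TopologicalSpace.Opens ℂ) : Subalgebra ℂ (U → ℂ) where
  carrier := {f | AnalyticOnNhd ℂ (extendZero U f) U}
  mul_mem' {f g} hf hg := analyticOnNhd_extendZero (AnalyticOnNhd.mul hf hg) fun x => by
    simp [extendZero_apply]
  add_mem' {f g} hf hg := analyticOnNhd_extendZero (AnalyticOnNhd.add hf hg) fun x => by
    simp [extendZero_apply]
  algebraMap_mem' c := analyticOnNhd_extendZero (F := fun _ => c) analyticOnNhd_const fun _ => rfl

variable {U V : TopologicalSpace.Opens ℂ} {n : ℕ}

/-- The coordinate function `x` on `U`. -/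
def Hol.coord (U : TopologicalSpace.Opens ℂ) : Hol U :=
  ⟨fun x => x, analyticOnNhd_extendZero analyticOnNhd_id fun _ => rfl⟩

/-- Restriction of analytic functions from `U` to a smaller open set `V`. -/
def Hol.restrict (h : V ≤ U) : Hol U →ₐ[ℂ] Hol V where
  toFun f := ⟨fun x => f.1 ⟨x, h x.2⟩,
    analyticOnNhd_extendZero (F := extendZero U f.1) (f.2.mono h) fun x =>
      (extendZero_apply f.1 ⟨x, h x.2⟩).symm⟩
  map_one' := rfl
  map_mul' _ _ := rfl
  map_zero' := rfl
  map_add' _ _ := rfl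
  commutes' _ := rfl

theorem differentiableAt_extendZero (f : Hol U) (x : U) :
    DifferentiableAt ℂ (extendZero U f.1) x := (f.2 x x.2).differentiableAt

theorem deriv_extendZero_congr {f : U → ℂ} {F : ℂ → ℂ} (h : ∀ x : U, f x = F x) (x : U) :
    deriv (extendZero U f) x = deriv F x :=
  ((extendZero_congr h).symm.eventuallyEq_of_mem (U.isOpen.mem_nhds x.2)).deriv_eq

/-- The complex derivative `d/dx`, as a derivation of the ring of analytic functions on `U`. -/
def Hol.deriv (U : TopologicalSpace.Opens ℂ) : Derivation ℂ (Hol U) (Hol U) :=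
  Derivation.mk'
    { toFun := fun f => ⟨fun x => _root_.deriv (extendZero U f.1) x,
        analyticOnNhd_extendZero (AnalyticOnNhd.deriv f.2) fun _ => rfl⟩
      map_add' := fun f g => by
        ext x
        change _root_.deriv (extendZero U (f.1 + g.1)) x =
          _root_.deriv (extendZero U f.1) x + _root_.deriv (extendZero U g.1) x
        rw [deriv_extendZero_congr (F := extendZero U f.1 + extendZero U g.1)
          (fun x => by simp [extendZero_apply])]
        exact deriv_add (differentiableAt_extendZero f x) (differentiableAt_extendZero g x)
      map_smul' := fun c f => by
        ext x
        change _root_.deriv (extendZero U (c • f.1)) x = c • _root_.deriv (extendZero U f.1) x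
        rw [deriv_extendZero_congr (F := c • extendZero U f.1)
          (fun x => by simp [extendZero_apply])]
        exact deriv_const_smul c (differentiableAt_extendZero f x) }
    (fun f g => by
      ext x
      change _root_.deriv (extendZero U (f.1 * g.1)) x =
        f.1 x * _root_.deriv (extendZero U g.1) x + g.1 x * _root_.deriv (extendZero U f.1) x
      rw [deriv_extendZero_congr (F := extendZero U f.1 * extendZero U g.1)
        (fun x => by simp [extendZero_apply]), deriv_mul (differentiableAt_extendZero f x)
        (differentiableAt_extendZero g x), extendZero_apply, extendZero_apply]
      ring)

/-- The ring of formal power series in `z_1, …, z_n` whose coefficients are analytic functions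
of `x ∈ U`: for `U = annulus r R` these are the `D_{r,R}`-transversely formal series and for
`U = disk R` the `D_R`-transversely formal series. -/
abbrev Series (U : TopologicalSpace.Opens ℂ) (n : ℕ) : Type := MvPowerSeries (Fin n) (Hol U)

/-- Restriction of transversely formal series, coefficient by coefficient. -/
def Series.restrict (h : V ≤ U) : Series U n →+* Series V n :=
  MvPowerSeries.map (Hol.restrict h).toRingHom

/-- The variable `x`, as a transversely formal series. -/
def varX (U : TopologicalSpace.Opens ℂ) (n : ℕ) : Series U n := MvPowerSeries.C (Hol.coord U)

/-- The variable `z_i`, as a transversely formal series. -/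
def varZ (U : TopologicalSpace.Opens ℂ) (i : Fin n) : Series U n := MvPowerSeries.X i

/-- A transversely formal vector field: a `ℂ`-linear derivation of the ring of transversely formal
series. The Lie bracket `⁅X, Y⁆ = X ∘ Y - Y ∘ X` is the commutator of derivations. -/
abbrev VectorField (U : TopologicalSpace.Opens ℂ) (n : ℕ) : Type :=
  Derivation ℂ (Series U n) (Series U n)

/-- The vector field `∂_x`: it differentiates every coefficient with respect to `x`. -/
def partialX (U : TopologicalSpace.Opens ℂ) (n : ℕ) : VectorField U n :=
  Derivation.mk'
    { toFun := fun f K => Hol.deriv U (MvPowerSeries.coeff K f)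
      map_add' := fun f g => by
        ext1 K
        exact map_add (Hol.deriv U) (MvPowerSeries.coeff K f) (MvPowerSeries.coeff K g)
      map_smul' := fun c f => by
        ext1 K
        exact (Hol.deriv U).map_smul c (MvPowerSeries.coeff K f) }
    (fun f g => by
      classical
      ext1 K
      change Hol.deriv U (MvPowerSeries.coeff K (f * g)) = MvPowerSeries.coeff K (f * _ + g * _)
      rw [mul_comm g, map_add, MvPowerSeries.coeff_mul, MvPowerSeries.coeff_mul,
        MvPowerSeries.coeff_mul, map_sum, ← Finset.sum_add_distrib]
      refine Finset.sum_congr rfl fun p _ => ?_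
      rw [Derivation.leibniz, smul_eq_mul, smul_eq_mul, mul_comm (MvPowerSeries.coeff p.2 g)]
      rfl)

/-- The vector field `∂_{z_i}`. -/
def partialZ (U : TopologicalSpace.Opens ℂ) (i : Fin n) : VectorField U n :=
  (MvPowerSeries.pderiv (Hol U) i).restrictScalars ℂ

/-- The vector field `f ∂_x + ∑ i, g i ∂_{z_i}`. -/
def vectorField (f : Series U n) (g : Fin n → Series U n) : VectorField U n :=
  f • partialX U n + ∑ i, g i • partialZ U i

/-- Restriction of a vector field from `U` to a smaller open set `V`, obtained by restricting its
components `X(x)`, `X(z_1)`, …, `X(z_n)`. -/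
def VectorField.restrict (h : V ≤ U) (X : VectorField U n) : VectorField V n :=
  vectorField (Series.restrict h (X (varX U n))) fun i => Series.restrict h (X (varZ U i))

/-- The ideal `𝔪 = ⟨z_1, …, z_n⟩` of the ring of transversely formal series. -/
def idealM (U : TopologicalSpace.Opens ℂ) (n : ℕ) : Ideal (Series U n) :=
  Ideal.span (Set.range fun i : Fin n => varZ U i)

/-- A vector field is `x`-normalized if it has the form
`x ∂_x + ∑ i, ∑ j, a i j z_j ∂_{z_i} + ∑ i, b i ∂_{z_i}` with a constant matrix `a` and all
`b i` in `𝔪 ^ 2`. -/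
def IsXNormalized (X : VectorField U n) : Prop :=
  ∃ (a : Matrix (Fin n) (Fin n) ℂ) (b : Fin n → Series U n),
    (∀ i, b i ∈ idealM U n ^ 2) ∧
      X = vectorField (varX U n) fun i => (∑ j, a i j • varZ U j) + b i

/-- The value `f(0, 0)` of a transversely formal series at the origin `(x, z) = (0, 0)`. -/
def valueAtOrigin (h0 : (0 : ℂ) ∈ U) (f : Series U n) : ℂ :=
  (MvPowerSeries.constantCoeff f).1 ⟨0, h0⟩

/-- The coordinates `(x, z_1, …, z_n)`. -/
def coordinates (U : TopologicalSpace.Opens ℂ) (n : ℕ) : Unit ⊕ Fin n → Series U n :=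
  Sum.elim (fun _ => varX U n) fun i => varZ U i

/-- The coordinate derivations `(∂_x, ∂_{z_1}, …, ∂_{z_n})`. -/
def partials (U : TopologicalSpace.Opens ℂ) (n : ℕ) : Unit ⊕ Fin n → VectorField U n :=
  Sum.elim (fun _ => partialX U n) fun i => partialZ U i

/-- The linear part of a vector field at the origin: the Jacobian matrix at `(x, z) = (0, 0)` of
its components. -/
def linearPart (h0 : (0 : ℂ) ∈ U) (X : VectorField U n) :
    Matrix (Unit ⊕ Fin n) (Unit ⊕ Fin n) ℂ :=
  Matrix.of fun k l => valueAtOrigin h0 (partials U n l (X (coordinates U n k)))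

/-- A vector field with eigenvalues `1, μ_1, …, μ_n` of its linear part (counted with
multiplicity) has no transverse negative resonance if no element `∑ i, p i * μ i` with
`p i ∈ ℤ_{≥ 0}` and `∑ i, p i ≥ 1` is of the form `μ j + q` with `q ∈ ℤ_{≥ 1}`. -/
def NoTransverseNegativeResonance (h0 : (0 : ℂ) ∈ U) (X : VectorField U n) : Prop :=
  ∃ μ : Fin n → ℂ,
    (linearPart h0 X).charpoly =
      (Polynomial.X - Polynomial.C 1) * ∏ i, (Polynomial.X - Polynomial.C (μ i)) ∧
    ∀ p : Fin n → ℕ, 1 ≤ ∑ i, p i → ∀ (j : Fin n) (q : ℕ), 1 ≤ q →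
      ∑ i, (p i : ℂ) * μ i ≠ μ j + (q : ℂ)

end TransverselyFormal

end

/-! ### Analytic extension from the annulus to the disk. -/

noncomputable section

namespace TransverselyFormal

open Metric Set Complex Filter Topology
open scoped Real

/-! The analytic input concerns one function of `x`. If `x u' - c u` extends to the disk, the
Laurent coefficients of `u` satisfy `(q + c) u_{-q} = 0` for `q ≥ 1`, so `u` extends unless `c` is a
negative integer (`exists_extension_of_euler`, where moments on circles play the role of the
`u_{-q}`).

The algebraic part reduces to this case. Let `H` be the image of the functions on the disk, and
filter series by `lowCoeff H n d`. Write `g i`, `y i` for the `z_i`-components of `X`, `Y`. Suppose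
all `y i` lie in one step of the filtration but not all in the next. Since `X (y k) = Y (g k)`,
modulo the next step `X` acts on the `y k` through the matrix `a`, so some combination `w` of them
is an eigenvector there, with eigenvalue some `μ j`. The operators `∂_{z_k}` lower the degree, and
their commutators with `X` again involve `a` to leading order. Hence suitable combinations of
derivatives remain eigenvectors, the eigenvalue dropping by some `μ i` each time
(`HasLinearPart.exists_euler_eigenvector`). In degree zero a function `h ∉ H` is left with `x h' -
(μ j - ∑ p i μ i) h ∈ H`, and nonresonance forces `h ∈ H`. Neither `a` nor `X` has to be
diagonalized. -/

/-- If all moments of `f` on the circle of radius `ρ` vanish, then its Cauchy integral vanishes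
outside of the circle. -/
theorem circleIntegral_sub_inv_mul_eq_zero {f : ℂ → ℂ} {ρ : ℝ} (hρ : 0 < ρ)
    (hf : ContinuousOn f (sphere 0 ρ)) (hm : ∀ k : ℕ, (∮ w in C(0, ρ), w ^ k * f w) = 0)
    {x : ℂ} (hx : ρ < ‖x‖) : (∮ w in C(0, ρ), (w - x)⁻¹ * f w) = 0 := by
  have hne : ∀ w ∈ sphere (0 : ℂ) ρ, w - x ≠ 0 := fun w hw h => by
    rw [sub_eq_zero] at h
    rw [mem_sphere_zero_iff_norm, h] at hw
    exact hx.ne' hw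
  have hc : ContinuousOn (fun w => (w - x)⁻¹ * f w) (sphere 0 ρ) :=
    ((continuousOn_id.sub continuousOn_const).inv₀ hne).mul hf
  -- Since `w^(N+1)/(w - x) = w^N + x w^N/(w - x)` and the moments vanish, powers of `w` leave the
  -- integral as powers of `x`. On the circle `|w| = ρ < |x|`, so the integral is `O((ρ/|x|)^N)`.
  have hI : ∀ N : ℕ, (∮ w in C(0, ρ), w ^ N * ((w - x)⁻¹ * f w)) =
      x ^ N * ∮ w in C(0, ρ), (w - x)⁻¹ * f w := by
    intro N
    induction N with
    | zero => simp
    | succ N ih =>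
      have h1 : CircleIntegrable (fun w => w ^ N * f w) 0 ρ :=
        (((continuous_pow N).continuousOn).mul hf).circleIntegrable hρ.le
      have h2 : CircleIntegrable (fun w => x * (w ^ N * ((w - x)⁻¹ * f w))) 0 ρ :=
        (continuousOn_const.mul (((continuous_pow N).continuousOn).mul hc)).circleIntegrable hρ.le
      have h3 := circleIntegral.integral_add h1 h2
      rw [hm N, zero_add, circleIntegral.integral_const_mul, ih, ← mul_assoc, ← pow_succ'] at h3
      rw [← h3]
      refine circleIntegral.integral_congr hρ.le fun w hw => ?_
      have := hne w hw
      field_simp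
      ring
  obtain ⟨C, hC⟩ := (isCompact_sphere (0 : ℂ) ρ).exists_bound_of_continuousOn hc
  have hx0 : 0 < ‖x‖ := hρ.trans hx
  have hb : ∀ N : ℕ, ‖∮ w in C(0, ρ), (w - x)⁻¹ * f w‖ ≤ 2 * π * ρ * C * (ρ / ‖x‖) ^ N := by
    intro N
    have h := circleIntegral.norm_integral_le_of_norm_le_const (c := 0)
      (f := fun w => w ^ N * ((w - x)⁻¹ * f w)) (C := ρ ^ N * C) hρ.le (fun w hw => by
        rw [norm_mul, norm_pow, mem_sphere_zero_iff_norm.1 hw]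
        exact mul_le_mul_of_nonneg_left (hC w hw) (by positivity))
    rw [hI, norm_mul, norm_pow] at h
    rw [div_pow, mul_div_assoc', le_div_iff₀ (by positivity)]
    linarith
  have hlim : Tendsto (fun N : ℕ => 2 * π * ρ * C * (ρ / ‖x‖) ^ N) atTop (𝓝 0) := by
    simpa using (tendsto_pow_atTop_nhds_zero_of_lt_one (by positivity)
      ((div_lt_one hx0).2 hx)).const_mul (2 * π * ρ * C)
  exact norm_le_zero_iff.1 (ge_of_tendsto' hlim hb)

theorem differentiableAt_of_annulus {u : ℂ → ℂ} {r R : ℝ}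
    (hu : DifferentiableOn ℂ u (annulus r R)) {x : ℂ} (h1 : r < ‖x‖) (h2 : ‖x‖ < R) :
    DifferentiableAt ℂ u x :=
  hu.differentiableAt ((annulus r R).isOpen.mem_nhds ⟨h1, h2⟩)

theorem differentiableAt_of_disk {u : ℂ → ℂ} {R : ℝ}
    (hu : DifferentiableOn ℂ u (disk R)) {x : ℂ} (h2 : ‖x‖ < R) :
    DifferentiableAt ℂ u x :=
  hu.differentiableAt ((disk R).isOpen.mem_nhds h2)

/-- Cauchy's integral formula in an annulus for a function with vanishing moments. -/
theorem circleIntegral_sub_inv_mul_of_moments {u : ℂ → ℂ} {r R : ℝ} (hr : 0 < r)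
    (hu : DifferentiableOn ℂ u (annulus r R))
    (hm : ∀ ρ, r < ρ → ρ < R → ∀ k : ℕ, (∮ w in C(0, ρ), w ^ k * u w) = 0)
    {ρ : ℝ} (hρR : ρ < R) {x : ℂ} (hx : r < ‖x‖) (hxρ : ‖x‖ < ρ) :
    (∮ w in C(0, ρ), (w - x)⁻¹ * u w) = 2 * π * I * u x := by
  obtain ⟨ρ₁, h1, h2⟩ := exists_between hx
  have hρ₁ : 0 < ρ₁ := hr.trans h1
  have hρ : 0 < ρ := (hρ₁.trans h2).trans hxρ
  -- The difference quotient has no pole at `x`, so its integrals over circles on either side of `x`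
  -- agree. On the inner circle, both the Cauchy integral of `u` and that of the kernel vanish.
  have hd : DifferentiableOn ℂ (dslope u x) (annulus r R) :=
    (differentiableOn_dslope ((annulus r R).isOpen.mem_nhds ⟨hx, hxρ.trans hρR⟩)).2 hu
  have hcu : ∀ s, r < s → s < R → ContinuousOn u (sphere 0 s) := fun s h h' =>
    hu.continuousOn.mono fun w hw => by
      rw [mem_sphere_zero_iff_norm] at hw
      exact ⟨hw ▸ h, hw ▸ h'⟩
  have key : ∀ s, r < s → s < R → s ≠ ‖x‖ → (∮ w in C(0, s), dslope u x w) =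
      (∮ w in C(0, s), (w - x)⁻¹ * u w) - (∮ w in C(0, s), (w - x)⁻¹) * u x := by
    intro s hs hsR hsx
    have hs0 : 0 < s := hr.trans hs
    have hne : ∀ w ∈ sphere (0 : ℂ) s, w - x ≠ 0 := fun w hw h => by
      rw [sub_eq_zero] at h
      rw [mem_sphere_zero_iff_norm, h] at hw
      exact hsx hw.symm
    have hc : ContinuousOn (fun w => (w - x)⁻¹) (sphere 0 s) :=
      (continuousOn_id.sub continuousOn_const).inv₀ hne
    have i1 : CircleIntegrable (fun w => (w - x)⁻¹ * u w) 0 s :=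
      (hc.mul (hcu s hs hsR)).circleIntegrable hs0.le
    have i2 : CircleIntegrable (fun w => u x * (w - x)⁻¹) 0 s :=
      (continuousOn_const.mul hc).circleIntegrable hs0.le
    rw [mul_comm _ (u x), ← circleIntegral.integral_const_mul, ← circleIntegral.integral_sub i1 i2]
    refine circleIntegral.integral_congr hs0.le fun w hw => ?_
    rw [dslope_of_ne _ (sub_ne_zero.1 (hne w hw)), slope_def_field]
    have := hne w hw
    field_simp
  have heq : (∮ w in C(0, ρ), dslope u x w) = ∮ w in C(0, ρ₁), dslope u x w := by
    refine circleIntegral_eq_of_differentiable_on_annulus_off_countable hρ₁ (h2.trans hxρ).le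
      countable_empty (hd.continuousOn.mono fun w hw => ?_) fun w hw => ?_
    · simp only [Set.mem_sdiff, mem_closedBall_zero_iff, mem_ball_zero_iff, not_lt] at hw
      exact ⟨h1.trans_le hw.2, hw.1.trans_lt hρR⟩
    · simp only [Set.mem_sdiff, mem_closedBall_zero_iff, mem_ball_zero_iff, not_le] at hw
      exact differentiableAt_of_annulus hd (h1.trans hw.1.2) (hw.1.1.trans hρR)
  rw [key ρ (hx.trans hxρ) hρR hxρ.ne', key ρ₁ h1 (h2.trans (hxρ.trans hρR)) h2.ne,
    circleIntegral_sub_inv_mul_eq_zero hρ₁ (hcu ρ₁ h1 (h2.trans (hxρ.trans hρR)))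
      (hm ρ₁ h1 (h2.trans (hxρ.trans hρR))) h2,
    circleIntegral.integral_sub_inv_of_mem_ball (by simpa using hxρ)] at heq
  have h0 : (∮ w in C(0, ρ₁), (w - x)⁻¹) = 0 := by
    refine DiffContOnCl.circleIntegral_eq_zero hρ₁.le (DifferentiableOn.diffContOnCl ?_)
    intro w hw
    have hw' : ‖w‖ ≤ ρ₁ := by simpa using closure_ball_subset_closedBall hw
    refine ((differentiableAt_id.sub_const x).inv ?_).differentiableWithinAt
    intro h
    rw [id, sub_eq_zero] at h
    exact absurd h2 (not_lt.2 (h ▸ hw'))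
  rw [h0] at heq
  linear_combination heq

/-- An analytic function on an annulus all of whose nonnegative moments vanish extends to the
disk. -/
theorem exists_extension_of_moments {u : ℂ → ℂ} {r R : ℝ} (hr : 0 < r) (hrR : r < R)
    (hu : DifferentiableOn ℂ u (annulus r R))
    (hm : ∀ ρ, r < ρ → ρ < R → ∀ k : ℕ, (∮ w in C(0, ρ), w ^ k * u w) = 0) :
    ∃ F : ℂ → ℂ, DifferentiableOn ℂ F (disk R) ∧ EqOn F u (annulus r R) := by
  obtain ⟨ρ, h1, h2⟩ := exists_between hrR
  have hρ : 0 < ρ := hr.trans h1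
  have hcu : ContinuousOn u (sphere 0 ρ) := hu.continuousOn.mono fun w hw => by
    rw [mem_sphere_zero_iff_norm] at hw
    exact ⟨hw ▸ h1, hw ▸ h2⟩
  set v : ℂ → ℂ := fun w => (2 * π * I : ℂ)⁻¹ • ∮ z in C(0, ρ), (z - w)⁻¹ • u z with hv
  have hvd : ∀ x : ℂ, ‖x‖ < ρ → DifferentiableAt ℂ v x := by
    intro x hx
    lift ρ to NNReal using hρ.le
    have := hasFPowerSeriesOn_cauchy_integral (hcu.circleIntegrable hρ.le)
      (by exact_mod_cast hρ)
    refine (this.analyticAt_of_mem ?_).differentiableAt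
    simpa [Metric.eball_coe] using hx
  have hvu : ∀ x : ℂ, r < ‖x‖ → ‖x‖ < ρ → v x = u x := by
    intro x hx hxρ
    simp only [hv, smul_eq_mul]
    rw [circleIntegral_sub_inv_mul_of_moments hr hu hm h2 hx hxρ,
      inv_mul_cancel_left₀ two_pi_I_ne_zero]
  classical
  refine ⟨fun x => if ‖x‖ < ρ then v x else u x, fun x hx => ?_, fun x hx => ?_⟩
  · refine DifferentiableAt.differentiableWithinAt ?_
    rcases lt_or_ge ‖x‖ ρ with h | h
    · refine (hvd x h).congr_of_eventuallyEq ?_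
      filter_upwards [(isOpen_lt continuous_norm continuous_const).mem_nhds h] with y hy
      exact if_pos hy
    -- On all of `r < |y|` the glued function equals `u`, because `v = u` on the overlap.
    · refine (differentiableAt_of_annulus hu (h1.trans_le h) hx).congr_of_eventuallyEq ?_
      filter_upwards [(isOpen_lt continuous_const continuous_norm).mem_nhds (h1.trans_le h)]
        with y hy
      split_ifs with hy'
      · exact hvu y hy hy'
      · rfl
  · simp only
    split_ifs with h
    · exact hvu x hx.1 h
    · rfl

/-- A solution on an annulus of `x u' - c u = h` with `h` analytic on the disk extends to the disk,
unless `c` is a negative integer. -/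
theorem exists_extension_of_euler {u h : ℂ → ℂ} {r R : ℝ} {c : ℂ} (hr : 0 < r) (hrR : r < R)
    (hc : ∀ q : ℕ, 1 ≤ q → c ≠ -q) (hu : DifferentiableOn ℂ u (annulus r R))
    (hh : DifferentiableOn ℂ h (disk R))
    (heq : ∀ x ∈ annulus r R, x * deriv u x - c * u x = h x) :
    ∃ F : ℂ → ℂ, DifferentiableOn ℂ F (disk R) ∧ EqOn F u (annulus r R) := by
  refine exists_extension_of_moments hr hrR hu fun ρ h1 h2 k => ?_
  have hρ : 0 < ρ := hr.trans h1
  have hcu : ContinuousOn u (sphere 0 ρ) := hu.continuousOn.mono fun w hw => by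
    rw [mem_sphere_zero_iff_norm] at hw
    exact ⟨hw ▸ h1, hw ▸ h2⟩
  have hch : ContinuousOn h (closedBall 0 ρ) := hh.continuousOn.mono fun w hw => by
    rw [mem_closedBall_zero_iff] at hw
    exact hw.trans_lt h2
  -- By the differential equation the integrand is the derivative of `w^(k+1) u`.
  have e1 : (∮ w in C(0, ρ), ((k + 1 + c) * (w ^ k * u w) + w ^ k * h w)) = 0 := by
    refine circleIntegral.integral_eq_zero_of_hasDerivWithinAt (f := fun w => w ^ (k + 1) * u w)
      hρ.le fun w hw => ?_
    rw [mem_sphere_zero_iff_norm] at hw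
    have hw1 : r < ‖w‖ := hw ▸ h1
    have hw2 : ‖w‖ < R := hw ▸ h2
    have := ((hasDerivAt_pow (k + 1) w).mul
      (differentiableAt_of_annulus hu hw1 hw2).hasDerivAt).hasDerivWithinAt (s := sphere 0 ρ)
    refine this.congr_deriv ?_
    rw [← heq w ⟨hw1, hw2⟩]
    push_cast
    ring
  have e2 : (∮ w in C(0, ρ), w ^ k * h w) = 0 := by
    refine DiffContOnCl.circleIntegral_eq_zero hρ.le (DifferentiableOn.diffContOnCl ?_)
    intro w hw
    have hw' : ‖w‖ ≤ ρ := by simpa using closure_ball_subset_closedBall hw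
    exact ((differentiableAt_pow k).mul
      (differentiableAt_of_disk hh (hw'.trans_lt h2))).differentiableWithinAt
  have hck := (continuous_pow (M := ℂ) k).continuousOn (s := sphere 0 ρ)
  have i1 : CircleIntegrable (fun w => (k + 1 + c) * (w ^ k * u w)) 0 ρ :=
    (continuousOn_const.mul (hck.mul hcu)).circleIntegrable hρ.le
  have i2 : CircleIntegrable (fun w => w ^ k * h w) 0 ρ :=
    (hck.mul (hch.mono sphere_subset_closedBall)).circleIntegrable hρ.le
  rw [circleIntegral.integral_add i1 i2, e2, add_zero,
    circleIntegral.integral_const_mul] at e1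
  refine (mul_eq_zero.1 e1).resolve_left fun h0 => hc (k + 1) (by omega) ?_
  push_cast
  linear_combination h0

/-- The Euler equation `x g' - c g = h` for elements of the rings of analytic functions. -/
theorem mem_range_restrict_of_euler {r R : ℝ} {c : ℂ} (hr : 0 < r) (hrR : r < R)
    (hc : ∀ q : ℕ, 1 ≤ q → c ≠ -q) (g : Hol (annulus r R))
    (hg : Hol.coord (annulus r R) * Hol.deriv (annulus r R) g - c • g ∈
      (Hol.restrict (annulus_le_disk r R)).range) :
    g ∈ (Hol.restrict (annulus_le_disk r R)).range := by
  obtain ⟨h, hh⟩ := hg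
  obtain ⟨F, hF, hFu⟩ := exists_extension_of_euler (u := extendZero _ g.1)
    (h := extendZero _ h.1) hr hrR hc g.2.differentiableOn h.2.differentiableOn (fun x hx => by
      have := congrFun (congrArg Subtype.val hh) ⟨x, hx⟩
      change h.1 ⟨x, hx.2⟩ = x * _root_.deriv (extendZero _ g.1) x - c * g.1 ⟨x, hx⟩ at this
      rw [← extendZero_apply g.1, ← extendZero_apply h.1] at this
      exact this.symm)
  refine ⟨⟨fun x => F x, analyticOnNhd_extendZero (F := F)
    ((analyticOnNhd_iff_differentiableOn (disk R).isOpen).2 hF) fun _ => rfl⟩, ?_⟩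
  ext x
  exact (hFu x.2).trans (extendZero_apply g.1 x)

end TransverselyFormal

end

noncomputable section

namespace TransverselyFormal

variable {U : TopologicalSpace.Opens ℂ} {n : ℕ}

/-! ### Eigenvectors modulo a submodule. -/

section LinearAlgebra

variable {V W : Type*} [AddCommGroup V] [Module ℂ V] [AddCommGroup W] [Module ℂ W]

/-- If a product of operators `T - μ` maps a space into a proper submodule, then one of the factors
has an eigenvector modulo that submodule. -/
theorem exists_eigenvector_mod (T : Module.End ℂ W) (K : Submodule ℂ W) (l : List ℂ) {w : W}
    (hw : w ∉ K) (hl : (l.map fun μ => T - algebraMap ℂ (Module.End ℂ W) μ).prod w ∈ K) :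
    ∃ v ∉ K, ∃ μ ∈ l, T v - μ • v ∈ K := by
  induction l with
  | nil => exact absurd hl hw
  | cons μ l ih =>
    -- Stability of `K` under `T` is not needed: the vector starts outside `K` and ends inside, so
    -- some single factor carries it into `K`.
    by_cases h : (l.map fun μ => T - algebraMap ℂ (Module.End ℂ W) μ).prod w ∈ K
    · obtain ⟨v, hv, ν, hν, h'⟩ := ih h
      exact ⟨v, hv, ν, List.mem_cons_of_mem _ hν, h'⟩
    · exact ⟨_, h, μ, List.mem_cons_self, hl⟩

/-- If `D Z_k ≡ ∑ i, B i k • Z_i` modulo a submodule `N` that does not contain all `Z_k`, then some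
combination of the `Z_k` is an eigenvector of `D` modulo `N`, for an eigenvalue of `B`. -/
theorem exists_eigenvector_combination (B : Matrix (Fin n) (Fin n) ℂ) (μ : Fin n → ℂ)
    (hB : B.charpoly = ∏ i, (Polynomial.X - Polynomial.C (μ i))) (D : V →ₗ[ℂ] V)
    (N : Submodule ℂ V) (Z : Fin n → V) (hZ : ∃ k, Z k ∉ N)
    (hD : ∀ k, D (Z k) - ∑ i, B i k • Z i ∈ N) :
    ∃ f ∈ Submodule.span ℂ (Set.range Z), f ∉ N ∧ ∃ j, D f - μ j • f ∈ N := by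
  classical
  set ζ : (Fin n → ℂ) →ₗ[ℂ] V := Fintype.linearCombination ℂ Z with hζ
  have hζs : ∀ w, ζ w = ∑ k, w k • Z k := fun w => rfl
  obtain ⟨k, hk⟩ := hZ
  have hk' : Pi.single k (1 : ℂ) ∉ N.comap ζ := by
    rw [Submodule.mem_comap, hζ, Fintype.linearCombination_apply_single, one_smul]
    exact hk
  -- Cayley–Hamilton. Working on coefficient vectors in `ℂ^n` avoids any independence assumption on
  -- the `Z k`.
  have hprod : ((List.ofFn μ).map fun c =>
      B.toLin' - algebraMap ℂ (Module.End ℂ (Fin n → ℂ)) c).prod = 0 := by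
    have h := LinearMap.aeval_self_charpoly B.toLin'
    rw [Matrix.charpoly_toLin', hB, ← List.prod_ofFn, map_list_prod] at h
    rw [← h]
    congr 1
    simp [Function.comp_def]
  obtain ⟨v, hv, c, hc, h⟩ := exists_eigenvector_mod B.toLin' (N.comap ζ) (List.ofFn μ) hk'
    (by rw [hprod]; exact zero_mem _)
  obtain ⟨j, rfl⟩ := (List.mem_ofFn' μ c).1 hc
  refine ⟨ζ v, ?_, hv, j, ?_⟩
  · rw [hζs]
    exact Submodule.sum_mem _ fun i _ =>
      Submodule.smul_mem _ _ (Submodule.subset_span (Set.mem_range_self i))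
  · have h1 : D (ζ v) - ζ (B.toLin' v) ∈ N := by
      have : D (ζ v) - ζ (B.toLin' v) = ∑ k, v k • (D (Z k) - ∑ i, B i k • Z i) := by
        simp only [hζs, map_sum, map_smul, smul_sub, Finset.sum_sub_distrib, Finset.smul_sum,
          smul_smul, Matrix.toLin'_apply, Matrix.mulVec, dotProduct, Finset.sum_smul]
        rw [Finset.sum_comm]
        simp only [mul_comm]
      rw [this]
      exact N.sum_mem fun k _ => N.smul_mem _ (hD k)
    have h2 := N.add_mem h1 h
    rw [map_sub, map_smul, sub_add_sub_cancel] at h2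
    exact h2

end LinearAlgebra

/-! ### The coefficient filtration and descent in degree. -/

section CoeffFiltration

variable (H : Subalgebra ℂ (Hol U))

/-- The series all of whose coefficients of degree less than `d` belong to `H`. -/
def lowCoeff (n d : ℕ) : Submodule ℂ (Series U n) where
  carrier := {f | ∀ K : Fin n →₀ ℕ, K.degree < d → MvPowerSeries.coeff K f ∈ H}
  add_mem' hf hg K hK := by
    rw [map_add]
    exact H.add_mem (hf K hK) (hg K hK)
  zero_mem' K _ := by
    rw [map_zero]
    exact H.zero_mem
  smul_mem' c f hf K hK := H.smul_mem (hf K hK) c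

variable {H}

theorem mem_lowCoeff {d : ℕ} {f : Series U n} : f ∈ lowCoeff H n d ↔
    ∀ K : Fin n →₀ ℕ, K.degree < d → MvPowerSeries.coeff K f ∈ H := Iff.rfl

/-- In each term of a product coefficient of degree below `d + e`, either the second exponent has
degree below `e` and the term vanishes, or the first has degree below `d`. -/
theorem mul_mem_lowCoeff {d e : ℕ} {f g : Series U n} (hf : f ∈ lowCoeff H n d)
    (hg : ∀ K, MvPowerSeries.coeff K g ∈ H)
    (hg0 : ∀ K : Fin n →₀ ℕ, K.degree < e → MvPowerSeries.coeff K g = 0) :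
    f * g ∈ lowCoeff H n (d + e) := by
  classical
  intro K hK
  rw [MvPowerSeries.coeff_mul]
  refine H.sum_mem fun p hp => ?_
  replace hp := Finset.HasAntidiagonal.mem_antidiagonal.1 hp
  by_cases h : p.2.degree < e
  · rw [hg0 _ h, mul_zero]
    exact H.zero_mem
  · refine H.mul_mem (hf _ ?_) (hg _)
    rw [← hp, map_add] at hK
    omega

theorem coeff_partialZ (f : Series U n) (k : Fin n) (K : Fin n →₀ ℕ) :
    MvPowerSeries.coeff K (partialZ U k f) =
      ((K k + 1 : ℕ) : ℂ) • MvPowerSeries.coeff (K + Finsupp.single k 1) f := by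
  refine (MvPowerSeries.coeff_pderiv f K).trans ?_
  rw [Algebra.smul_def, mul_comm, map_natCast, Nat.cast_succ]

theorem coeff_partialX (f : Series U n) (K : Fin n →₀ ℕ) :
    MvPowerSeries.coeff K (partialX U n f) = Hol.deriv U (MvPowerSeries.coeff K f) := rfl

theorem partialZ_mem_lowCoeff {d : ℕ} {f : Series U n} (hf : f ∈ lowCoeff H n (d + 1))
    (k : Fin n) : partialZ U k f ∈ lowCoeff H n d := by
  intro K hK
  rw [coeff_partialZ]
  refine H.smul_mem (hf _ ?_) _
  rw [map_add, Finsupp.degree_single]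
  omega

/-- An offending exponent has degree exactly `d + 1 > 0`, hence involves some `z_k`. Then `∂_{z_k}`
only multiplies its coefficient by a nonzero integer, which can be inverted. -/
theorem exists_partialZ_notMem_lowCoeff {d : ℕ} {f : Series U n}
    (hf : f ∈ lowCoeff H n (d + 1)) (hf' : f ∉ lowCoeff H n (d + 2)) :
    ∃ k, partialZ U k f ∉ lowCoeff H n (d + 1) := by
  rw [mem_lowCoeff] at hf'
  push Not at hf'
  obtain ⟨K, hK, hKf⟩ := hf'
  have hK0 : K ≠ 0 := by
    rintro rfl
    exact hKf (hf 0 (by simp))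
  obtain ⟨k, hk⟩ := Finsupp.ne_iff.1 hK0
  rw [Finsupp.coe_zero, Pi.zero_apply] at hk
  have hle : Finsupp.single k 1 ≤ K := Finsupp.single_le_iff.2 (Nat.one_le_iff_ne_zero.2 hk)
  refine ⟨k, fun h => hKf ?_⟩
  have hKk : K - Finsupp.single k 1 + Finsupp.single k 1 = K := tsub_add_cancel_of_le hle
  have h1 := h (K - Finsupp.single k 1) (by
    have := congrArg Finsupp.degree hKk
    rw [map_add, Finsupp.degree_single] at this
    omega)
  rw [coeff_partialZ, hKk] at h1
  have h2 := H.smul_mem h1 ((((K - Finsupp.single k 1 : Fin n →₀ ℕ) k + 1 : ℕ) : ℂ)⁻¹)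
  rwa [inv_smul_smul₀ (Nat.cast_ne_zero.2 (Nat.succ_ne_zero _))] at h2

theorem partialZ_partialX (k : Fin n) (f : Series U n) :
    partialZ U k (partialX U n f) = partialX U n (partialZ U k f) := by
  ext1 K
  rw [coeff_partialX, coeff_partialZ, coeff_partialZ, coeff_partialX, Derivation.map_smul]

theorem partialZ_comm (k i : Fin n) (f : Series U n) :
    partialZ U k (partialZ U i f) = partialZ U i (partialZ U k f) := by
  ext1 K
  by_cases h : k = i
  · rw [h]
  · simp only [coeff_partialZ, smul_smul, Finsupp.add_apply, Finsupp.single_eq_of_ne h,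
      Finsupp.single_eq_of_ne (Ne.symm h), add_zero]
    rw [mul_comm, add_right_comm]

theorem vectorField_apply (g₀ : Series U n) (g : Fin n → Series U n) (f : Series U n) :
    vectorField g₀ g f = g₀ * partialX U n f + ∑ i, g i * partialZ U i f := by
  have h : (∑ i, g i • partialZ U i) f = ∑ i, (g i • partialZ U i) f := by
    rw [← Finset.sum_apply]
    exact congrFun (map_sum (Derivation.coeFnAddMonoidHom (R := ℂ) (A := Series U n)
      (M := Series U n)) (fun i => g i • partialZ U i) Finset.univ) f
  simp only [vectorField, Derivation.add_apply, Derivation.smul_apply, smul_eq_mul, h]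

theorem coeff_varX_mul (f : Series U n) (K : Fin n →₀ ℕ) :
    MvPowerSeries.coeff K (varX U n * f) = Hol.coord U * MvPowerSeries.coeff K f :=
  MvPowerSeries.coeff_C_mul K f _

theorem partialZ_varX (k : Fin n) : partialZ U k (varX U n) = 0 := MvPowerSeries.pderiv_C

/-- This is the commutator of `∂_{z_k}` with the field. It has no `∂_x` term because the
`∂_x`-component `x` does not depend on `z`. -/
theorem partialZ_vectorField (g : Fin n → Series U n) (k : Fin n) (f : Series U n) :
    partialZ U k (vectorField (varX U n) g f) =
      vectorField (varX U n) g (partialZ U k f) + ∑ i, partialZ U i f * partialZ U k (g i) := by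
  simp only [vectorField_apply, map_add, map_sum, Derivation.leibniz, partialZ_varX, smul_eq_mul,
    mul_zero, zero_add, partialZ_partialX, partialZ_comm k, Finset.sum_add_distrib, add_assoc]

/-- The components `g i` have coefficients in `H` and linear part `∑ j, a i j • z_j`. -/
structure HasLinearPart (H : Subalgebra ℂ (Hol U)) (a : Matrix (Fin n) (Fin n) ℂ)
    (g : Fin n → Series U n) : Prop where
  mem : ∀ i K, MvPowerSeries.coeff K (g i) ∈ H
  zero : ∀ i, MvPowerSeries.coeff 0 (g i) = 0
  one : ∀ i j, MvPowerSeries.coeff (Finsupp.single j 1) (g i) = algebraMap ℂ (Hol U) (a i j)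

variable {a : Matrix (Fin n) (Fin n) ℂ} {g : Fin n → Series U n}

theorem varX_mul_partialX_mem_lowCoeff
    (hH : ∀ h ∈ H, Hol.coord U * Hol.deriv U h ∈ H) {d : ℕ} {f : Series U n}
    (hf : f ∈ lowCoeff H n d) : varX U n * partialX U n f ∈ lowCoeff H n d := by
  intro K hK
  rw [coeff_varX_mul, coeff_partialX]
  exact hH _ (hf K hK)

/-- The series `∂_{z_k} (g i) - a i k` has no constant term, so multiplying by it gains one degree:
only the linear part matters to leading order. -/
theorem HasLinearPart.mul_partialZ_sub_mem_lowCoeff (hg : HasLinearPart H a g) {d : ℕ}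
    {f : Series U n} (hf : f ∈ lowCoeff H n d) (i k : Fin n) :
    f * partialZ U k (g i) - a i k • f ∈ lowCoeff H n (d + 1) := by
  have h : f * partialZ U k (g i) - a i k • f =
      f * (partialZ U k (g i) - algebraMap ℂ (Series U n) (a i k)) := by
    rw [Algebra.smul_def]
    ring
  have hc : algebraMap ℂ (Series U n) (a i k) =
    MvPowerSeries.C (algebraMap ℂ (Hol U) (a i k)) := MvPowerSeries.algebraMap_apply
  rw [h]
  refine mul_mem_lowCoeff hf (fun K => ?_) fun K hK => ?_
  · rw [map_sub, coeff_partialZ, hc]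
    refine H.sub_mem (H.smul_mem (hg.mem _ _) _) ?_
    classical
    rw [MvPowerSeries.coeff_C]
    split_ifs
    · exact H.algebraMap_mem _
    · exact H.zero_mem
  · have hK0 : K = 0 := (Finsupp.degree_eq_zero_iff K).1 (by omega)
    subst hK0
    rw [map_sub, coeff_partialZ, hc, zero_add, hg.one, MvPowerSeries.coeff_zero_C]
    simp

/-- The leading coefficient of an eigenvector modulo `lowCoeff H n (d + 1)` is reduced, by repeated
differentiation in the directions `z_k`, to an eigenvector of `x d/dx` modulo `H`. -/
theorem HasLinearPart.exists_euler_eigenvector (hg : HasLinearPart H a g) {μ : Fin n → ℂ}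
    (ha : a.charpoly = ∏ i, (Polynomial.X - Polynomial.C (μ i))) (d : ℕ) :
    ∀ (c : ℂ) (f : Series U n), f ∈ lowCoeff H n d → f ∉ lowCoeff H n (d + 1) →
      vectorField (varX U n) g f - c • f ∈ lowCoeff H n (d + 1) →
      ∃ p : Fin n → ℕ, ∑ i, p i = d ∧ ∃ h ∉ H,
        Hol.coord U * Hol.deriv U h - (c - ∑ i, (p i : ℂ) * μ i) • h ∈ H := by
  induction d with
  | zero =>
    intro c f _ hf' hc
    refine ⟨0, by simp, MvPowerSeries.coeff 0 f, fun h => hf' fun K hK => ?_, ?_⟩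
    · rwa [(Finsupp.degree_eq_zero_iff K).1 (by omega)]
    · have h := hc 0 (by simp)
      -- The `g i` vanish at `z = 0`, so only `x ∂_x` contributes in degree zero.
      have h0 : ∀ i, MvPowerSeries.coeff 0 (g i * partialZ U i f) = 0 := fun i => by
        have := map_mul (MvPowerSeries.constantCoeff (σ := Fin n) (R := Hol U)) (g i)
          (partialZ U i f)
        simp only [← MvPowerSeries.coeff_zero_eq_constantCoeff_apply, hg.zero, zero_mul] at this
        exact this
      rw [map_sub, vectorField_apply, map_add, map_sum, Finset.sum_eq_zero fun i _ => h0 i,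
        add_zero, coeff_varX_mul, coeff_partialX] at h
      simpa using h
  | succ d ih =>
    intro c f hf hf' hc
    -- With `X` the given field, the commutator formula makes `c - X`, rather than `X`, act on the
    -- `∂_{z_k} f` through `a`. An eigenvalue `μ j` of `c - X` is an eigenvalue `c - μ j` of `X`.
    have hD : ∀ k, ((c • LinearMap.id : Series U n →ₗ[ℂ] Series U n) -
        (vectorField (varX U n) g : Series U n →ₗ[ℂ] Series U n)) (partialZ U k f) -
        ∑ i, a i k • partialZ U i f ∈ lowCoeff H n (d + 1) := by
      intro k
      have h1 := partialZ_mem_lowCoeff hc k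
      have h2 : ∑ i, (partialZ U i f * partialZ U k (g i) - a i k • partialZ U i f) ∈
          lowCoeff H n (d + 1) := Submodule.sum_mem _ fun i _ =>
        hg.mul_partialZ_sub_mem_lowCoeff (partialZ_mem_lowCoeff hf i) i k
      have h3 := Submodule.sub_mem _ h2 h1
      rw [map_sub, partialZ_vectorField, Derivation.map_smul, Finset.sum_sub_distrib] at h3
      convert h3 using 1
      simp only [LinearMap.sub_apply, LinearMap.smul_apply, LinearMap.id_apply,
        Derivation.coeFn_coe]
      abel
    obtain ⟨w, hw, hw', j, hj⟩ := exists_eigenvector_combination a μ ha _ (lowCoeff H n (d + 1))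
      (fun k => partialZ U k f) (exists_partialZ_notMem_lowCoeff hf hf') hD
    have hwd : w ∈ lowCoeff H n d := by
      refine Submodule.span_le.2 ?_ hw
      rintro _ ⟨k, rfl⟩
      exact partialZ_mem_lowCoeff hf k
    obtain ⟨p, hp, h, hh, hhe⟩ := ih (c - μ j) w hwd hw' (by
      have := Submodule.neg_mem _ hj
      convert this using 1
      simp only [LinearMap.sub_apply, LinearMap.smul_apply, LinearMap.id_apply,
        Derivation.coeFn_coe, sub_smul]
      abel)
    refine ⟨p + Pi.single j 1, ?_, h, hh, ?_⟩
    · simp [Finset.sum_add_distrib, hp]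
    · convert hhe using 3
      simp only [Pi.add_apply, Nat.cast_add, add_mul, Finset.sum_add_distrib]
      rw [Finset.sum_eq_single_of_mem (f := fun i => ((Pi.single j 1 : Fin n → ℕ) i : ℂ) * μ i) j
        (Finset.mem_univ j) fun i _ hi => by simp [hi]]
      simp only [Pi.single_eq_same, Nat.cast_one, one_mul]
      ring

/-- Under the nonresonance condition, the components of a normalized vector field that commutes with
one having coefficients in `H` have coefficients in `H`. -/
theorem HasLinearPart.coeff_mem_of_commute (hH : ∀ h ∈ H, Hol.coord U * Hol.deriv U h ∈ H)
    (hext : ∀ (c : ℂ) (h : Hol U), (∀ q : ℕ, 1 ≤ q → c ≠ -q) →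
      Hol.coord U * Hol.deriv U h - c • h ∈ H → h ∈ H)
    (hg : HasLinearPart H a g) {μ : Fin n → ℂ}
    (ha : a.charpoly = ∏ i, (Polynomial.X - Polynomial.C (μ i)))
    (hμ : ∀ p : Fin n → ℕ, 1 ≤ ∑ i, p i → ∀ (j : Fin n) (q : ℕ), 1 ≤ q →
      ∑ i, (p i : ℂ) * μ i ≠ μ j + (q : ℂ))
    {y : Fin n → Series U n} (hy : ∀ i, MvPowerSeries.coeff 0 (y i) = 0)
    (hgy : ∀ i, vectorField (varX U n) g (y i) = vectorField (varX U n) y (g i)) (i : Fin n)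
    (K : Fin n →₀ ℕ) : MvPowerSeries.coeff K (y i) ∈ H := by
  suffices h : ∀ d i, y i ∈ lowCoeff H n (d + 1) from h K.degree i K (Nat.lt_succ_self _)
  intro d
  induction d with
  | zero =>
    intro i K hK
    rw [(Finsupp.degree_eq_zero_iff K).1 (by omega), hy]
    exact H.zero_mem
  | succ d ih =>
    by_contra! hcon
    -- By commutation this is `x ∂_x (g k) + ∑ j, y j ∂_{z_j} (g k)`. The first term has
    -- coefficients in `H`; the rest reduces to row `k` of `a`, whence the transpose, which has the
    -- same characteristic polynomial.
    have hD : ∀ k, (vectorField (varX U n) g : Series U n →ₗ[ℂ] Series U n) (y k) -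
        ∑ j, a.transpose j k • y j ∈ lowCoeff H n (d + 1 + 1) := by
      intro k
      rw [Derivation.coeFn_coe, hgy, vectorField_apply, add_sub_assoc, ← Finset.sum_sub_distrib]
      exact Submodule.add_mem _ (varX_mul_partialX_mem_lowCoeff hH fun K _ => hg.mem k K)
        (Submodule.sum_mem _ fun j _ => hg.mul_partialZ_sub_mem_lowCoeff (ih j) k j)
    obtain ⟨w, hw, hw', j, hj⟩ := exists_eigenvector_combination a.transpose μ
      (by rw [Matrix.charpoly_transpose, ha]) _ _ y hcon hD
    have hwd : w ∈ lowCoeff H n (d + 1) := by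
      refine Submodule.span_le.2 ?_ hw
      rintro _ ⟨k, rfl⟩
      exact ih k
    obtain ⟨p, hp, h, hh, hhe⟩ := hg.exists_euler_eigenvector ha (d + 1) (μ j) w hwd hw' hj
    -- An excluded value `μ j - ∑ p i μ i = -q` would be a resonance, with `∑ p i = d + 1 ≥ 1`.
    refine hh (hext _ h (fun q hq hc => hμ p (by omega) j q hq ?_) hhe)
    linear_combination -hc

end CoeffFiltration

end TransverselyFormal

end

/-! ### Powers of the ideal of the variables, components and normal forms. -/

noncomputable section

namespace TransverselyFormal

variable {U V : TopologicalSpace.Opens ℂ} {n : ℕ}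

section IdealM

theorem coeff_eq_zero_of_mem_idealM_sq {f : Series U n} (hf : f ∈ idealM U n ^ 2)
    {K : Fin n →₀ ℕ} (hK : K.degree < 2) : MvPowerSeries.coeff K f = 0 := by
  classical
  have h1 : ∀ f ∈ idealM U n, MvPowerSeries.coeff 0 f = 0 := fun f hf => by
    have hle : idealM U n ≤ RingHom.ker (MvPowerSeries.constantCoeff (σ := Fin n) (R := Hol U)) := by
      refine Ideal.span_le.2 ?_
      rintro _ ⟨i, rfl⟩
      exact MvPowerSeries.coeff_zero_X i
    exact hle hf
  rw [pow_two] at hf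
  refine Submodule.mul_induction_on hf (fun g hg h hh => ?_) fun g h hg hh => ?_
  · rw [MvPowerSeries.coeff_mul]
    refine Finset.sum_eq_zero fun p hp => ?_
    replace hp := Finset.HasAntidiagonal.mem_antidiagonal.1 hp
    rw [← hp, map_add] at hK
    rcases Nat.eq_zero_or_pos p.1.degree with h0 | h0
    · rw [(Finsupp.degree_eq_zero_iff _).1 h0, h1 g hg, zero_mul]
    · rw [(Finsupp.degree_eq_zero_iff p.2).1 (by omega), h1 h hh, mul_zero]
  · rw [map_add, hg, hh, add_zero]

/-- A series without terms of degree `≤ d` is a combination of the variables with coefficients that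
have no terms of degree `< d`. -/
theorem exists_eq_sum_varZ_mul {d : ℕ} {f : Series U n}
    (hf : ∀ K : Fin n →₀ ℕ, K.degree < d + 1 → MvPowerSeries.coeff K f = 0) :
    ∃ g : Fin n → Series U n, f = ∑ i, varZ U i * g i ∧
      ∀ i (K : Fin n →₀ ℕ), K.degree < d → MvPowerSeries.coeff K (g i) = 0 := by
  classical
  have hex : ∀ K : {K : Fin n →₀ ℕ // K ≠ 0}, ∃ i, K.1 i ≠ 0 := fun K => by
    simpa using Finsupp.ne_iff.1 K.2
  -- Each nonconstant monomial is assigned to one variable dividing it, so that it is counted once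
  -- in the sum.
  choose m hm using hex
  let g : Fin n → Series U n := fun i K =>
    if h : K + Finsupp.single i 1 ≠ 0 then
      if m ⟨_, h⟩ = i then MvPowerSeries.coeff (K + Finsupp.single i 1) f else 0 else 0
  have hg : ∀ i K, MvPowerSeries.coeff K (g i) =
    if h : K + Finsupp.single i 1 ≠ 0 then
      if m ⟨_, h⟩ = i then MvPowerSeries.coeff (K + Finsupp.single i 1) f else 0 else 0 :=
    fun i K => rfl
  refine ⟨g, ?_, fun i K hK => ?_⟩
  · ext1 K
    rw [map_sum]
    have hX : ∀ i, MvPowerSeries.coeff K (varZ U i * g i) =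
        if h : K ≠ 0 then if m ⟨K, h⟩ = i then MvPowerSeries.coeff K f else 0 else 0 := by
      intro i
      rw [varZ, MvPowerSeries.X, MvPowerSeries.coeff_monomial_mul, one_mul]
      by_cases hle : Finsupp.single i 1 ≤ K
      · have hKk : K - Finsupp.single i 1 + Finsupp.single i 1 = K := tsub_add_cancel_of_le hle
        rw [if_pos hle, hg]
        simp only [hKk]
      · rw [if_neg hle]
        split_ifs with h h'
        · refine absurd (Finsupp.single_le_iff.2 ?_) hle
          exact Nat.one_le_iff_ne_zero.2 (h' ▸ hm ⟨K, h⟩)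
        · rfl
        · rfl
    simp only [hX]
    by_cases h : K ≠ 0
    · simp [h]
    · simp only [h, dite_false, Finset.sum_const_zero]
      rw [not_not] at h
      exact hf K (by simp [h])
  · rw [hg]
    split_ifs
    · refine hf _ ?_
      rw [map_add, Finsupp.degree_single]
      omega
    · rfl
    · rfl

/-- One variable is factored out at a time; having finitely many variables makes each step a finite
sum, although the series are infinite. -/
theorem mem_idealM_pow {d : ℕ} : ∀ {f : Series U n},
    (∀ K : Fin n →₀ ℕ, K.degree < d → MvPowerSeries.coeff K f = 0) → f ∈ idealM U n ^ d := by
  induction d with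
  | zero => intro f _; simp
  | succ d ih =>
    intro f hf
    obtain ⟨g, rfl, hg⟩ := exists_eq_sum_varZ_mul hf
    rw [pow_succ']
    exact Ideal.sum_mem _ fun i _ =>
      Ideal.mul_mem_mul (Ideal.subset_span ⟨i, rfl⟩) (ih (hg i))

end IdealM

section Components

theorem partialX_varZ (i : Fin n) : partialX U n (varZ U i) = 0 := by
  classical
  ext1 K
  rw [coeff_partialX, varZ, MvPowerSeries.coeff_X]
  split_ifs
  · rw [Derivation.map_one_eq_zero, map_zero]
  · rw [map_zero, map_zero]

theorem partialX_varX : partialX U n (varX U n) = 1 := by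
  classical
  ext1 K
  rw [coeff_partialX, varX, MvPowerSeries.coeff_C, MvPowerSeries.coeff_one]
  split_ifs
  · ext x
    change deriv (extendZero U fun x => x) x = 1
    exact (deriv_extendZero_congr (F := id) (fun _ => rfl) x).trans (deriv_id _)
  · rw [map_zero]

theorem partialZ_varZ (i j : Fin n) : partialZ U j (varZ U i) = if i = j then 1 else 0 := by
  split_ifs with h
  · subst h
    exact MvPowerSeries.pderiv_X_self
  · exact MvPowerSeries.pderiv_X_of_ne h

theorem vectorField_varX (g₀ : Series U n) (g : Fin n → Series U n) :
    vectorField g₀ g (varX U n) = g₀ := by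
  simp [vectorField_apply, partialX_varX, partialZ_varX]

theorem vectorField_varZ (g₀ : Series U n) (g : Fin n → Series U n) (i : Fin n) :
    vectorField g₀ g (varZ U i) = g i := by
  simp [vectorField_apply, partialX_varZ, partialZ_varZ]

theorem coeff_restrict (h : V ≤ U) (f : Series U n) (K : Fin n →₀ ℕ) :
    MvPowerSeries.coeff K (Series.restrict h f) = Hol.restrict h (MvPowerSeries.coeff K f) := rfl

theorem restrict_varX (h : V ≤ U) : Series.restrict h (varX U n) = varX V n :=
  MvPowerSeries.map_C _ _

theorem restrict_vectorField (h : V ≤ U) (g : Fin n → Series U n) :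
    (vectorField (varX U n) g).restrict h =
      vectorField (varX V n) fun i => Series.restrict h (g i) := by
  simp only [VectorField.restrict, vectorField_varX, vectorField_varZ, restrict_varX]

/-- The coefficients of degree at most one of the components of an `x`-normalized vector field. -/
theorem coeff_linear_add (a : Matrix (Fin n) (Fin n) ℂ) {b : Fin n → Series U n}
    (hb : ∀ i, b i ∈ idealM U n ^ 2) (i : Fin n) :
    MvPowerSeries.coeff 0 ((∑ j, a i j • varZ U j) + b i) = 0 ∧
      ∀ k, MvPowerSeries.coeff (Finsupp.single k 1) ((∑ j, a i j • varZ U j) + b i) =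
        algebraMap ℂ (Hol U) (a i k) := by
  classical
  have hs : ∀ K (c : ℂ) (f : Series U n),
    MvPowerSeries.coeff K (c • f) = c • MvPowerSeries.coeff K f := fun _ _ _ => rfl
  constructor
  · rw [map_add, coeff_eq_zero_of_mem_idealM_sq (hb i) (by simp), map_sum, add_zero]
    refine Finset.sum_eq_zero fun j _ => ?_
    rw [hs, varZ, MvPowerSeries.coeff_zero_X, smul_zero]
  · intro k
    rw [map_add, coeff_eq_zero_of_mem_idealM_sq (hb i) (by simp), map_sum, add_zero]
    simp [hs, varZ, MvPowerSeries.coeff_index_single_X, Algebra.algebraMap_eq_smul_one]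

theorem coeff_linear_add_of_two_le (a : Matrix (Fin n) (Fin n) ℂ) (b : Fin n → Series U n)
    (i : Fin n) {K : Fin n →₀ ℕ} (hK : 2 ≤ K.degree) :
    MvPowerSeries.coeff K ((∑ j, a i j • varZ U j) + b i) = MvPowerSeries.coeff K (b i) := by
  classical
  have hs : ∀ K (c : ℂ) (f : Series U n),
    MvPowerSeries.coeff K (c • f) = c • MvPowerSeries.coeff K f := fun _ _ _ => rfl
  rw [map_add, map_sum, Finset.sum_eq_zero, zero_add]
  intro j _
  rw [hs, varZ, MvPowerSeries.coeff_X, if_neg, smul_zero]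
  rintro rfl
  simp at hK

/-- The linear part is block diagonal: the `x`-component is `x`, and the other components vanish
identically on `z = 0`. Cancelling the factor of the eigenvalue `1` identifies the `μ i` as the
eigenvalues of `a`. -/
theorem charpoly_linearPart (h0 : (0 : ℂ) ∈ U) (a : Matrix (Fin n) (Fin n) ℂ)
    {b : Fin n → Series U n} (hb : ∀ i, b i ∈ idealM U n ^ 2) :
    (linearPart h0 (vectorField (varX U n) fun i => (∑ j, a i j • varZ U j) + b i)).charpoly =
      (Polynomial.X - Polynomial.C 1) * a.charpoly := by
  have h : linearPart h0 (vectorField (varX U n) fun i => (∑ j, a i j • varZ U j) + b i) =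
      Matrix.fromBlocks 1 0 0 a := by
    ext k l
    rcases k with k | k <;> rcases l with l | l
    · simp only [linearPart, Matrix.of_apply, partials, coordinates, Sum.elim_inl,
        vectorField_varX, partialX_varX, Matrix.fromBlocks_apply₁₁]
      simp [valueAtOrigin]
    · simp only [linearPart, Matrix.of_apply, partials, coordinates, Sum.elim_inl, Sum.elim_inr,
        vectorField_varX, partialZ_varX, Matrix.fromBlocks_apply₁₂]
      simp [valueAtOrigin]
    · simp only [linearPart, Matrix.of_apply, partials, coordinates, Sum.elim_inl, Sum.elim_inr,
        vectorField_varZ, Matrix.fromBlocks_apply₂₁, valueAtOrigin]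
      rw [← MvPowerSeries.coeff_zero_eq_constantCoeff_apply, coeff_partialX,
        (coeff_linear_add a hb k).1, map_zero]
      rfl
    · simp only [linearPart, Matrix.of_apply, partials, coordinates, Sum.elim_inr,
        vectorField_varZ, Matrix.fromBlocks_apply₂₂, valueAtOrigin]
      rw [← MvPowerSeries.coeff_zero_eq_constantCoeff_apply, coeff_partialZ, zero_add,
        (coeff_linear_add a hb k).2]
      simp [Algebra.algebraMap_eq_smul_one]
  rw [h, Matrix.charpoly_fromBlocks_zero₁₂]
  congr 1
  simp [Matrix.charpoly_one]

end Components

theorem hol_deriv_restrict (h : V ≤ U) (f : Hol U) :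
    Hol.deriv V (Hol.restrict h f) = Hol.restrict h (Hol.deriv U f) := by
  ext x
  exact (deriv_extendZero_congr (F := extendZero U f.1)
    (fun y => (extendZero_apply f.1 ⟨y, h y.2⟩).symm) x)

theorem coord_mul_deriv_mem_range_restrict (h : V ≤ U) :
    ∀ f ∈ (Hol.restrict h).range, Hol.coord V * Hol.deriv V f ∈ (Hol.restrict h).range := by
  rintro _ ⟨f, rfl⟩
  exact ⟨Hol.coord U * Hol.deriv U f, by
    rw [map_mul]
    change _ = _ * Hol.deriv V (Hol.restrict h f)
    rw [hol_deriv_restrict]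
    rfl⟩

/-- Lifting coefficients along a restriction preserves normal forms. -/
theorem exists_restrict_eq (h : V ≤ U) (a : Matrix (Fin n) (Fin n) ℂ) {b : Fin n → Series V n}
    (hb : ∀ i, b i ∈ idealM V n ^ 2)
    (hmem : ∀ i K, MvPowerSeries.coeff K (b i) ∈ (Hol.restrict h).range) :
    ∃ Y' : VectorField U n, IsXNormalized Y' ∧ Y'.restrict h =
      vectorField (varX V n) fun i => (∑ j, a i j • varZ V j) + b i := by
  classical
  choose c hc using hmem
  -- For a general `V`, such as the empty set, a chosen preimage of zero may be nonzero; low degrees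
  -- are set to zero to stay in the square of the ideal.
  let b' : Fin n → Series U n := fun i K => if K.degree < 2 then 0 else c i K
  have hb' : ∀ i K, MvPowerSeries.coeff K (b' i) = if K.degree < 2 then 0 else c i K :=
    fun _ _ => rfl
  refine ⟨_, ⟨a, b', fun i => mem_idealM_pow fun K hK => ?_, rfl⟩, ?_⟩
  · rw [hb', if_pos hK]
  · rw [restrict_vectorField]
    congr 1
    ext1 i
    rw [map_add, map_sum]
    congr 1
    · refine Finset.sum_congr rfl fun j _ => ?_
      ext1 K
      rw [coeff_restrict]
      change Hol.restrict h (a i j • MvPowerSeries.coeff K (varZ U j)) =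
        a i j • MvPowerSeries.coeff K (varZ V j)
      rw [map_smul, varZ, varZ, MvPowerSeries.coeff_X, MvPowerSeries.coeff_X]
      split_ifs
      · rw [map_one]
      · rw [map_zero]
    · ext1 K
      rw [coeff_restrict, hb']
      split_ifs with hK
      · rw [map_zero, coeff_eq_zero_of_mem_idealM_sq (hb i) hK]
      · exact hc i K

theorem hasLinearPart_restrict (h : V ≤ U) (a : Matrix (Fin n) (Fin n) ℂ)
    {b : Fin n → Series U n} (hb : ∀ i, b i ∈ idealM U n ^ 2) :
    HasLinearPart (Hol.restrict h).range a
      fun i => Series.restrict h ((∑ j, a i j • varZ U j) + b i) where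
  mem i K := ⟨_, (coeff_restrict h _ K).symm⟩
  zero i := by rw [coeff_restrict, (coeff_linear_add a hb i).1, map_zero]
  one i j := by rw [coeff_restrict, (coeff_linear_add a hb i).2, AlgHom.commutes]

end TransverselyFormal

end

theorem theorem1 (n : ℕ) (r R : ℝ) (hr : 0 < r) (hrR : r < R)
    (X : TransverselyFormal.VectorField (TransverselyFormal.disk R) n)
    (Y : TransverselyFormal.VectorField (TransverselyFormal.annulus r R) n)
    (hX : TransverselyFormal.IsXNormalized X)
    (hres : TransverselyFormal.NoTransverseNegativeResonance
      (TransverselyFormal.zero_mem_disk (hr.trans hrR)) X)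
    (hY : TransverselyFormal.IsXNormalized Y)
    (hXY : ⁅X.restrict (TransverselyFormal.annulus_le_disk r R), Y⁆ = 0) :
    ∃ Y' : TransverselyFormal.VectorField (TransverselyFormal.disk R) n,
      TransverselyFormal.IsXNormalized Y' ∧
        TransverselyFormal.VectorField.restrict (TransverselyFormal.annulus_le_disk r R) Y' = Y := by
  open TransverselyFormal in
  obtain ⟨a, b, hb, rfl⟩ := hX
  obtain ⟨a', b', hb', rfl⟩ := hY
  obtain ⟨μ, hchar, hμ⟩ := hres
  rw [charpoly_linearPart _ a hb] at hchar
  have ha := mul_left_cancel₀ (Polynomial.X_sub_C_ne_zero 1) hchar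
  refine exists_restrict_eq _ a' hb' fun i K => ?_
  by_cases hK : K.degree < 2
  · rw [coeff_eq_zero_of_mem_idealM_sq (hb' i) hK]
    exact zero_mem _
  · rw [← coeff_linear_add_of_two_le a' b' i (not_lt.1 hK)]
    refine (hasLinearPart_restrict _ a hb).coeff_mem_of_commute
      (y := fun i => (∑ j, a' i j • varZ _ j) + b' i) (coord_mul_deriv_mem_range_restrict _)
      (fun c h hc => mem_range_restrict_of_euler hr hrR hc h) ha hμ
      (fun i => (coeff_linear_add a' hb' i).1) (fun k => ?_) i K
    -- Evaluating the bracket at `z_k` gives `X (y k) = Y (g k)`.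
    have h := DFunLike.congr_fun hXY (varZ _ k)
    rw [restrict_vectorField, Derivation.commutator_apply, vectorField_varZ, vectorField_varZ,
      Derivation.zero_apply, sub_eq_zero] at h
    exact h
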